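/- **Proposition.** Let $V=\bigoplus_{m\in\mathbb{Z}}V_{(m)}$ be a vertex operator algebra over $\mathbb{C}$, with vertex operators $Y(u,x)=\sum_{n\in\mathbb{Z}}u_n x^{-n-1}$, $u_n\in\operatorname{End}V$, graded by the eigenspaces $V_{(m)}=\{v: L(0)v=mv\}$. For $u\in V$ let $X(u,x)=Y(x^{L(0)}u,x)$ be the modified vertex operator, where $x^{L(0)}u=\sum_m u_{(m)}x^m$ for $u=\sum_m u_{(m)}$ with $u_{(m)}\in V_{(m)}$ (so $X(u,x)=x^{d}\,Y(u,x)$ if $u\in V_{(d)}$). Then for every $n\in\mathbb{Z}$, every homogeneous $u\in V$, of weight $\mathrm{wt}\,u$, and every $v\in V$, $$(x_1-x_2)^n X(u,x_1)X(v,x_2)-(-x_2+x_1)^n X(v,x_2)X(u,x_1)=\sum_{j\in\mathbb{Z},\,k\ge n}\binom{\mathrm{wt}\,u-j-1}{k-n}x_1^{j}x_2^{n-j}X(u_kv,x_2)$$ as formal series in $x_1^{\pm1},x_2^{\pm1}$ with coefficients in $\operatorname{End}V$. Here $(x_1-x_2)^n=\sum_{i\ge0}\binom{n}{i}(-1)^i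 x_1^{n-i}x_2^i$ is expanded in nonnegative powers of $x_2$, $(-x_2+x_1)^n=\sum_{i\ge0}\binom{n}{i}(-x_2)^{n-i}x_1^{i}$ is expanded in nonnegative powers of $x_1$, and $\binom{a}{i}=a(a-1)\cdots(a-i+1)/i!$ for $a\in\mathbb{Z}$, $i\ge0$. Both products and the sum on the right exist: applied to any vector of $V$, each of their coefficients is a finite sum. -/

import Mathlib

noncomputable section

/-! ### Formal series

A formal series with coefficients in `M`, in finitely many commuting formal variables and with
arbitrary integral exponents in all of them, is the function sending an exponent vector to a
coefficient: the exponents form `ℤ` for one variable, `ℤ × ℤ` for the variables `x₁, x₂`, and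
`ℤ × ℤ × ℤ` for the variables `x₀, x₁, x₂` (in this order). -/

namespace FormalSeries

variable {Γ ι M : Type*} [AddCommGroup Γ] [AddCommGroup M]

/-- Multiplication of a formal series by the monomial `x ^ a`. -/
def monomialMul (a : Γ) (F : Γ → M) : Γ → M := fun p => F (p - a)

/-- A family of formal series can be summed: each monomial has a nonzero coefficient in only
finitely many members of the family. -/
def Summable (F : ι → Γ → M) : Prop := ∀ p, {i | F i p ≠ 0}.Finite

/-- The coefficientwise sum of a (summable) family of formal series. -/
def sum (F : ι → Γ → M) : Γ → M := fun p => ∑ᶠ i, F i p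

/-- The family whose sum is the product of the series `A = ∑ₐ A a • x ^ a`, with integer
coefficients, and the series `F`. -/
def mulFamily (A : Γ → ℤ) (F : Γ → M) : Γ → Γ → M := fun a => A a • monomialMul a F

/-- The product of `A` and `F` exists: each of its coefficients is a finite sum. -/
def MulExists (A : Γ → ℤ) (F : Γ → M) : Prop := Summable (mulFamily A F)

/-- The product of `A` and `F`. -/
def mul (A : Γ → ℤ) (F : Γ → M) : Γ → M := sum (mulFamily A F)

/-- `(x₁ - x₂) ^ n`, expanded in nonnegative integral powers of the second variable `x₂`:
`∑_{i ≥ 0} binom(n, i) (-1) ^ i x₁ ^ (n - i) x₂ ^ i`. -/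
def subPow (n : ℤ) : ℤ × ℤ → ℤ := fun p =>
  if 0 ≤ p.2 ∧ p.1 + p.2 = n then (p.2.negOnePow : ℤ) * Ring.choose n p.2.toNat else 0

/-- `(-x₂ + x₁) ^ n`, expanded in nonnegative integral powers of `x₁`:
`∑_{i ≥ 0} binom(n, i) (-1) ^ (n - i) x₂ ^ (n - i) x₁ ^ i`. -/
def negAddPow (n : ℤ) : ℤ × ℤ → ℤ := fun p =>
  if 0 ≤ p.1 ∧ p.1 + p.2 = n then (p.2.negOnePow : ℤ) * Ring.choose n p.1.toNat else 0

/-- `x₀⁻¹ δ((x₁ - x₂) / x₀) = ∑ₘ x₀ ^ (-m - 1) (x₁ - x₂) ^ m`. -/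
def deltaSub : ℤ × ℤ × ℤ → ℤ := fun p => subPow (-p.1 - 1) (p.2.1, p.2.2)

/-- `x₀⁻¹ δ((-x₂ + x₁) / x₀) = ∑ₘ x₀ ^ (-m - 1) (-x₂ + x₁) ^ m`. -/
def deltaNegAdd : ℤ × ℤ × ℤ → ℤ := fun p => negAddPow (-p.1 - 1) (p.2.1, p.2.2)

/-- `x₂⁻¹ δ((x₁ - x₀) / x₂) = ∑ₘ x₂ ^ (-m - 1) (x₁ - x₀) ^ m`. -/
def deltaIterate : ℤ × ℤ × ℤ → ℤ := fun p => subPow (-p.2.2 - 1) (p.2.1, p.1)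

/-- A series in `x₂`, regarded as a series in `x₁, x₂`. -/
def inX₂ (F : ℤ → M) : ℤ × ℤ → M := fun p => if p.1 = 0 then F p.2 else 0

/-- A series in `x₁, x₂`, regarded as a series in `x₀, x₁, x₂`. -/
def inX₁X₂ (F : ℤ × ℤ → M) : ℤ × ℤ × ℤ → M := fun p => if p.1 = 0 then F (p.2.1, p.2.2) else 0

/-- A series in `x₀, x₂`, regarded as a series in `x₀, x₁, x₂`. -/
def inX₀X₂ (F : ℤ × ℤ → M) : ℤ × ℤ × ℤ → M := fun p => if p.2.1 = 0 then F (p.1, p.2.2) else 0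

end FormalSeries

/-! ### Vertex operator algebras -/

open FormalSeries in
/-- A vertex operator algebra structure on a complex vector space `V`. Here
`HVertexOperator.coeff (Y v) p` is the coefficient of `x ^ p` in `Y(v, x)`, and
`VertexOperator.ncoeff (Y v) n` is `vₙ`, the coefficient of `x ^ (-n - 1)`. That `Y v` is a
`VertexOperator` contains the truncation condition that `Y(v, x)w` involves only finitely many
negative powers of `x`; it makes all products in the Jacobi identity exist. -/
structure VertexOperatorAlgebra (V : Type*) [AddCommGroup V] [Module ℂ V] where
  /-- The vertex operator map `v ↦ Y(v, x)`. -/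
  Y : V →ₗ[ℂ] VertexOperator ℂ V
  /-- The vacuum vector. -/
  vacuum : V
  /-- The conformal vector `ω`. -/
  conformal : V
  /-- The central charge (rank). -/
  centralCharge : ℂ
  /-- The weight spaces. -/
  grading : ℤ → Submodule ℂ V
  isInternal_grading : DirectSum.IsInternal grading
  finiteDimensional_grading : ∀ n, FiniteDimensional ℂ (grading n)
  grading_eq_bot : ∃ N : ℤ, ∀ n < N, grading n = ⊥
  vacuum_mem : vacuum ∈ grading 0
  conformal_mem : conformal ∈ grading 2
  /-- `Y(𝟏, x)` is the identity. -/
  coeff_vacuum : ∀ p : ℤ, HVertexOperator.coeff (Y vacuum) p = if p = 0 then LinearMap.id else 0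
  /-- `Y(v, x)𝟏` has no negative powers of `x`, ... -/
  creation_neg : ∀ (v : V) (p : ℤ), p < 0 → HVertexOperator.coeff (Y v) p vacuum = 0
  /-- ... and its constant term is `v`. -/
  creation_zero : ∀ v : V, HVertexOperator.coeff (Y v) 0 vacuum = v
  /-- The Jacobi identity
  `x₀⁻¹ δ((x₁ - x₂) / x₀) Y(u, x₁) Y(v, x₂) - x₀⁻¹ δ((-x₂ + x₁) / x₀) Y(v, x₂) Y(u, x₁)
    = x₂⁻¹ δ((x₁ - x₀) / x₂) Y(Y(u, x₀)v, x₂)`, applied to an arbitrary vector `w`. -/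
  jacobi : ∀ u v w : V,
    mul deltaSub (inX₁X₂ fun p =>
        HVertexOperator.coeff (Y u) p.1 (HVertexOperator.coeff (Y v) p.2 w))
      - mul deltaNegAdd (inX₁X₂ fun p =>
        HVertexOperator.coeff (Y v) p.2 (HVertexOperator.coeff (Y u) p.1 w))
      = mul deltaIterate (inX₀X₂ fun p =>
        HVertexOperator.coeff (Y (HVertexOperator.coeff (Y u) p.1 v)) p.2 w)
  /-- The Virasoro relations for `L(n) = ωₙ₊₁`. -/
  virasoro : ∀ m n : ℤ,
    VertexOperator.ncoeff (Y conformal) (m + 1) * VertexOperator.ncoeff (Y conformal) (n + 1)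
      - VertexOperator.ncoeff (Y conformal) (n + 1) * VertexOperator.ncoeff (Y conformal) (m + 1)
      = ((m : ℂ) - n) • VertexOperator.ncoeff (Y conformal) (m + n + 1)
        + (if m + n = 0 then ((m : ℂ) ^ 3 - m) / 12 * centralCharge else 0) •
          (1 : Module.End ℂ V)
  /-- `L(0)v = n v` for `v` of weight `n`. -/
  L_zero : ∀ (n : ℤ), ∀ v ∈ grading n, VertexOperator.ncoeff (Y conformal) 1 v = (n : ℂ) • v
  /-- The `L(-1)`-derivative property `Y(L(-1)v, x) = d/dx Y(v, x)`. -/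
  L_neg_one : ∀ (v : V) (p : ℤ),
    HVertexOperator.coeff (Y (VertexOperator.ncoeff (Y conformal) 0 v)) p
      = ((p : ℂ) + 1) • HVertexOperator.coeff (Y v) (p + 1)

namespace VertexOperatorAlgebra

variable {V : Type*} [AddCommGroup V] [Module ℂ V] (A : VertexOperatorAlgebra V)

/-- The mode `uₙ`: the coefficient of `x ^ (-n - 1)` in `Y(u, x)`. -/
def mode (u : V) (n : ℤ) : Module.End ℂ V := VertexOperator.ncoeff (A.Y u) n

/-- The formal series `x ^ L(0) u` with coefficients in `V`. As `L(0)` is multiplication by `m` on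
the vectors of weight `m`, the coefficient of `x ^ m` is the component of `u` of weight `m`. -/
def xPowLZero (u : V) : ℤ → V := fun m =>
  letI := A.isInternal_grading.chooseDecomposition
  (DirectSum.decompose A.grading u m : V)

/-- The modified vertex operator `X(u, x) = Y(x ^ L(0) u, x) = ∑ₘ x ^ m Y(uₘ, x)`, where
`x ^ L(0) u = ∑ₘ uₘ x ^ m` (a finite sum). -/
def X (u : V) : ℤ → Module.End ℂ V :=
  FormalSeries.sum fun m : ℤ =>
    FormalSeries.monomialMul m (HVertexOperator.coeff (A.Y (A.xPowLZero u m)))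

end VertexOperatorAlgebra

end

noncomputable section

/-! The coefficient of `x₀ ^ (-n - 1)` in the Jacobi identity (`jacobi_apply`) is already the
formula for `Y`. For `u`, `v` of weights `d`, `e`, passing from `Y` to `X` multiplies both products
by `x₁ ^ d x₂ ^ e`, so the binomial `binom(-p₁ - 1, i)` becomes `binom(d - p₁ - 1, i)`. Since
`u_{n+i} v` has weight `d + e - n - i - 1` (`mode_mem`), the exponents on the right add up to `p₁ +
p₂ - n`, whatever `i` is.

General `v` follows by linearity. The truncation condition gives the finiteness this needs. -/

theorem finsum_comp_of_injective {α β M : Type*} [AddCommMonoid M] {g : α → β}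
    (hg : Function.Injective g) (f : β → M) (h : ∀ b, f b ≠ 0 → b ∈ Set.range g) :
    ∑ᶠ b, f b = ∑ᶠ a, f (g a) := by
  rw [← finsum_mem_range hg, ← finsum_mem_univ]
  refine finsum_mem_inter_support_eq' f _ _ fun b hb => ?_
  simpa using h b hb

/-! ### Products of formal series and coefficients of the delta functions. -/

namespace FormalSeries

variable {Γ ι M : Type*} [AddCommGroup M]

theorem Summable.add {F G : ι → Γ → M} (hF : Summable F) (hG : Summable G) :
    Summable (F + G) := fun p =>
  ((hF p).union (hG p)).subset fun i hi => by
    by_contra h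
    simp only [Set.mem_union, Set.mem_ofPred_eq, not_or, not_not] at h
    exact hi (by simp [h.1, h.2])

theorem sum_add {F G : ι → Γ → M} (hF : Summable F) (hG : Summable G) :
    sum (F + G) = sum F + sum G := by
  funext p
  exact finsum_add_distrib (hF p) (hG p)

theorem sum_zero : sum (0 : ι → Γ → M) = 0 := by
  funext p
  simp [sum]

variable [AddCommGroup Γ]

theorem monomialMul_add (a : Γ) (F G : Γ → M) :
    monomialMul a (F + G) = monomialMul a F + monomialMul a G := rfl

theorem mulFamily_add (A : Γ → ℤ) (F G : Γ → M) :
    mulFamily A (F + G) = mulFamily A F + mulFamily A G := by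
  funext a
  simp [mulFamily, monomialMul_add]

theorem mulFamily_zero (A : Γ → ℤ) : mulFamily A (0 : Γ → M) = 0 := by
  funext a p
  simp [mulFamily, monomialMul]

theorem MulExists.add {A : Γ → ℤ} {F G : Γ → M} (hF : MulExists A F) (hG : MulExists A G) :
    MulExists A (F + G) := by
  rw [MulExists, mulFamily_add]
  exact Summable.add hF hG

theorem mul_add {A : Γ → ℤ} {F G : Γ → M} (hF : MulExists A F) (hG : MulExists A G) :
    mul A (F + G) = mul A F + mul A G := by
  rw [mul, mulFamily_add]
  exact sum_add hF hG

theorem mul_zero (A : Γ → ℤ) : mul A (0 : Γ → M) = 0 := by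
  rw [mul, mulFamily_zero, sum_zero]

theorem mul_apply (A : Γ → ℤ) (F : Γ → M) (p : Γ) : mul A F p = ∑ᶠ a, A a • F (p - a) := rfl

theorem mul_monomialMul (A : Γ → ℤ) (c : Γ) (F : Γ → M) :
    mul A (monomialMul c F) = monomialMul c (mul A F) := by
  funext p
  simp only [mul_apply, monomialMul, sub_right_comm]

theorem mulExists_subPow (n N : ℤ) (F : ℤ × ℤ → M) (hF : ∀ p, p.2 < N → F p = 0) :
    MulExists (subPow n) F := fun p => by
  refine ((Set.finite_Icc 0 (p.2 - N)).image fun i => (n - i, i)).subset fun a ha => ?_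
  have ha' : subPow n a • F (p - a) ≠ 0 := ha
  have h1 : 0 ≤ a.2 ∧ a.1 + a.2 = n := by
    by_contra h
    exact ha' (by simp [subPow, h])
  have h2 : ¬ (p - a).2 < N := fun h => ha' (by simp [hF _ h])
  rw [Prod.snd_sub] at h2
  exact ⟨a.2, ⟨h1.1, by omega⟩, Prod.ext (by simp; omega) rfl⟩

theorem mulExists_negAddPow (n N : ℤ) (F : ℤ × ℤ → M) (hF : ∀ p, p.1 < N → F p = 0) :
    MulExists (negAddPow n) F := fun p => by
  refine ((Set.finite_Icc 0 (p.1 - N)).image fun i => (i, n - i)).subset fun a ha => ?_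
  have ha' : negAddPow n a • F (p - a) ≠ 0 := ha
  have h1 : 0 ≤ a.1 ∧ a.1 + a.2 = n := by
    by_contra h
    exact ha' (by simp [negAddPow, h])
  have h2 : ¬ (p - a).1 < N := fun h => ha' (by simp [hF _ h])
  rw [Prod.fst_sub] at h2
  exact ⟨a.1, ⟨h1.1, by omega⟩, Prod.ext rfl (by simp; omega)⟩

theorem mul_inX₁X₂ (A : ℤ × ℤ × ℤ → ℤ) (F : ℤ × ℤ → M) (p : ℤ × ℤ × ℤ) :
    mul A (inX₁X₂ F) p = mul (fun a => A (p.1, a)) F p.2 := by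
  simp only [mul_apply]
  rw [finsum_comp_of_injective (Prod.mk_right_injective p.1)]
  · refine finsum_congr fun a => ?_
    simp only [inX₁X₂, Prod.fst_sub, sub_self, if_true]
    rfl
  · intro a ha
    refine ⟨a.2, Prod.ext ?_ rfl⟩
    by_contra h
    have h' : ¬ (p.1 - a.1 = 0) := fun h'' => h (by simp; omega)
    exact ha (by simp [inX₁X₂, h'])

theorem mul_deltaSub (F : ℤ × ℤ → M) (n : ℤ) (p : ℤ × ℤ) :
    mul deltaSub (inX₁X₂ F) (-n - 1, p) = mul (subPow n) F p := by
  rw [mul_inX₁X₂]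
  congr 1
  funext a
  simp [deltaSub]

theorem mul_deltaNegAdd (F : ℤ × ℤ → M) (n : ℤ) (p : ℤ × ℤ) :
    mul deltaNegAdd (inX₁X₂ F) (-n - 1, p) = mul (negAddPow n) F p := by
  rw [mul_inX₁X₂]
  congr 1
  funext a
  simp [deltaNegAdd]

theorem mul_deltaIterate (H : ℤ × ℤ → M) (n : ℤ) (p : ℤ × ℤ) :
    mul deltaIterate (inX₀X₂ H) (-n - 1, p) =
      ∑ᶠ i : ℕ, Ring.choose (-p.1 - 1) i • H (-(n + i) - 1, p.1 + p.2 + i + 1) := by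
  rw [mul_apply, finsum_comp_of_injective
    (g := fun i : ℕ => ((i : ℤ), p.1, -p.1 - i - 1))]
  · refine finsum_congr fun i => ?_
    have h1 : deltaIterate ((i : ℤ), p.1, -p.1 - i - 1) = Ring.choose (-p.1 - 1) i := by
      -- Upper negation, `binom(-a, i) = (-1) ^ i binom(a + i - 1, i)` with `a = p₁ + 1`, absorbs
      -- the sign from `(x₁ - x₀) ^ (p₁ + i)`.
      rw [show -p.1 - 1 = -(p.1 + 1) by ring, Ring.choose_neg]
      simp only [deltaIterate, subPow]
      rw [if_pos ⟨by positivity, by ring⟩, Int.toNat_natCast, Units.smul_def, smul_eq_mul]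
      congr 2
      ring
    rw [h1]
    simp only [inX₀X₂, Prod.mk_sub_mk, Prod.fst_sub, Prod.snd_sub, sub_self, if_true]
    congr 3 <;> ring
  · intro i j h
    simpa using congrArg Prod.fst h
  · intro a ha
    have h1 : 0 ≤ a.1 ∧ a.2.1 + a.1 = -a.2.2 - 1 := by
      by_contra h
      exact ha (by simp [deltaIterate, subPow, h])
    have h2 : p.1 = a.2.1 := by
      by_contra h
      have h' : ¬ (p.1 - a.2.1 = 0) := by omega
      exact ha (by simp [inX₀X₂, h'])
    exact ⟨a.1.toNat, Prod.ext (by simp; omega) (Prod.ext h2 (by simp; omega))⟩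

/-- At `n = 0` the Jacobi identity thus becomes the commutator formula, used for `[L(0), Y(v, x)]`.
-/
theorem mul_subPow_zero (F : ℤ × ℤ → M) : mul (subPow 0) F = F := by
  funext p
  rw [mul_apply, finsum_eq_single _ 0]
  · simp [subPow]
  · rintro ⟨a, b⟩ h
    by_cases hab : 0 ≤ b ∧ a + b = 0
    · have hb : 0 < b.toNat := by
        by_contra hb
        exact h (Prod.ext (by simp; omega) (by simp; omega))
      simp [subPow, Ring.choose_zero_pos ℤ hb]
    · simp [subPow, hab]

theorem mul_negAddPow_zero (F : ℤ × ℤ → M) : mul (negAddPow 0) F = F := by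
  funext p
  rw [mul_apply, finsum_eq_single _ 0]
  · simp [negAddPow]
  · rintro ⟨a, b⟩ h
    by_cases hab : 0 ≤ a ∧ a + b = 0
    · have hb : 0 < a.toNat := by
        by_contra hb
        exact h (Prod.ext (by simp; omega) (by simp; omega))
      simp [negAddPow, Ring.choose_zero_pos ℤ hb]
    · simp [negAddPow, hab]

end FormalSeries

/-! ### Weights and modified vertex operators. -/

namespace VertexOperatorAlgebra

open FormalSeries HVertexOperator

variable {V : Type*} [AddCommGroup V] [Module ℂ V] (A : VertexOperatorAlgebra V)

theorem exists_coeff_eq_zero (u w : V) : ∃ N : ℤ, ∀ p < N, coeff (A.Y u) p w = 0 :=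
  ⟨_, fun p hp => VertexOperator.coeff_eq_zero_of_lt_order (A.Y u) p w hp⟩

/-- The coefficients of the Jacobi identity at `x₀ ^ (-n - 1) x₁ ^ p.1 x₂ ^ p.2`. -/
theorem jacobi_apply (u v w : V) (n : ℤ) (p : ℤ × ℤ) :
    mul (subPow n) (fun p => coeff (A.Y u) p.1 (coeff (A.Y v) p.2 w)) p
      - mul (negAddPow n) (fun p => coeff (A.Y v) p.2 (coeff (A.Y u) p.1 w)) p
      = ∑ᶠ i : ℕ, Ring.choose (-p.1 - 1) i •
          coeff (A.Y (A.mode u (n + i) v)) (p.1 + p.2 + i + 1) w := by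
  have h := congrFun (A.jacobi u v w) (-n - 1, p)
  rw [Pi.sub_apply, mul_deltaSub, mul_deltaNegAdd, mul_deltaIterate] at h
  exact h

/-- `[L(0), Y(v, x)] = (x d/dx + wt v) Y(v, x)`. -/
theorem L_zero_coeff {e : ℤ} {v : V} (hv : v ∈ A.grading e) (p : ℤ) (w : V) :
    A.mode A.conformal 1 (coeff (A.Y v) p w) - coeff (A.Y v) p (A.mode A.conformal 1 w)
      = ((p : ℂ) + e) • coeff (A.Y v) p w := by
  -- `L(0) = ω₁` is the coefficient of `x₁ ^ (-2)`. The binomials are then `binom(1, i)`, leaving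
  -- only `L(-1)v` (`i = 0`) and `L(0)v` (`i = 1`).
  have h := A.jacobi_apply A.conformal v w 0 (-2, p)
  rw [mul_subPow_zero, mul_negAddPow_zero, finsum_eq_sum_of_support_subset (s := {0, 1})] at h
  · rw [Finset.sum_pair zero_ne_one] at h
    have h0 := congrArg (· w) (A.L_neg_one v (p - 1))
    have h1 := A.L_zero e v hv
    have e1 : (-2 : ℤ) + p + ((0 : ℕ) : ℤ) + 1 = p - 1 := by push_cast; ring
    have e2 : (-2 : ℤ) + p + ((1 : ℕ) : ℤ) + 1 = p := by push_cast; ring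
    simp only [e1, e2] at h
    simp only [mode, Nat.cast_zero, Nat.cast_one, add_zero, zero_add, h1, map_smul,
      Pi.smul_apply, LinearMap.smul_apply, h0, Ring.choose_zero_right, Ring.choose_one_right] at h
    rw [add_smul]
    refine h.trans ?_
    norm_num
  · intro i hi
    by_contra hi'
    have : 1 < i := by
      simp only [Finset.coe_insert, Finset.coe_singleton, Set.mem_insert_iff,
        Set.mem_singleton_iff, not_or] at hi'
      omega
    refine hi ?_
    have hc : Ring.choose (-(-2 : ℤ) - 1) i = 0 := by
      rw [show -(-2 : ℤ) - 1 = ((1 : ℕ) : ℤ) by norm_num, Ring.choose_natCast,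
        Nat.choose_eq_zero_of_lt this, Nat.cast_zero]
    simp only [hc, zero_smul]

@[elab_as_elim]
theorem grading_induction {motive : V → Prop} (v : V) (zero : motive 0)
    (homogeneous : ∀ (e : ℤ), ∀ v ∈ A.grading e, motive v)
    (add : ∀ u v, motive u → motive v → motive (u + v)) : motive v := by
  let := A.isInternal_grading.chooseDecomposition
  exact DirectSum.Decomposition.inductionOn A.grading zero
    (fun {e} v => homogeneous e v v.2) add v

theorem xPowLZero_add (u v : V) : A.xPowLZero (u + v) = A.xPowLZero u + A.xPowLZero v := by
  funext m
  simp [xPowLZero]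

theorem xPowLZero_zero : A.xPowLZero 0 = 0 := by
  funext m
  simp [xPowLZero]

theorem xPowLZero_of_mem {e : ℤ} {v : V} (hv : v ∈ A.grading e) (m : ℤ) :
    A.xPowLZero v m = if m = e then v else 0 := by
  let := A.isInternal_grading.chooseDecomposition
  split_ifs with h
  · subst h
    exact DirectSum.decompose_of_mem_same A.grading hv
  · exact DirectSum.decompose_of_mem_ne A.grading hv (Ne.symm h)

theorem finite_support_xPowLZero (u : V) : (Function.support (A.xPowLZero u)).Finite := by
  induction u using A.grading_induction with
  | zero => simp [xPowLZero_zero]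
  | homogeneous e v hv =>
    refine (Set.finite_singleton e).subset fun m hm => ?_
    by_contra h
    exact hm (by rw [A.xPowLZero_of_mem hv, if_neg (by simpa using h)])
  | add u v hu hv =>
    rw [xPowLZero_add]
    exact (hu.union hv).subset (Function.support_add _ _)

/-- `L(0)` multiplies the component of weight `k` by `k`, so an eigenvector for `m` has no component
of weight `k ≠ m`. This turns the commutator with `L(0)` into a weight computation. -/
theorem mem_grading_iff (m : ℤ) (v : V) :
    v ∈ A.grading m ↔ A.mode A.conformal 1 v = (m : ℂ) • v := by
  refine ⟨A.L_zero m v, fun h => ?_⟩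
  let := A.isInternal_grading.chooseDecomposition
  have key : ∀ x : V, ∀ k : ℤ, DirectSum.decompose A.grading (A.mode A.conformal 1 x) k
      = (k : ℂ) • DirectSum.decompose A.grading x k := by
    intro x k
    induction x using A.grading_induction with
    | zero => simp
    | homogeneous e v hv =>
      rw [show A.mode A.conformal 1 v = (e : ℂ) • v from A.L_zero e v hv,
        DirectSum.decompose_smul, DirectSum.smul_apply]
      by_cases hk : e = k
      · rw [hk]
      · have : DirectSum.decompose A.grading v k = 0 :=
          Subtype.ext (DirectSum.decompose_of_mem_ne A.grading hv hk)
        rw [this, smul_zero, smul_zero]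
    | add u v hu hv =>
      rw [map_add, DirectSum.decompose_add, DirectSum.decompose_add, DirectSum.add_apply,
        DirectSum.add_apply, hu, hv, smul_add]
  have hv : DirectSum.decompose A.grading v
      = DirectSum.of (fun i => A.grading i) m (DirectSum.decompose A.grading v m) := by
    refine DFinsupp.ext fun k => ?_
    by_cases hk : m = k
    · subst hk
      exact (DirectSum.of_eq_same (β := fun i => A.grading i) _ _).symm
    · have h1 := key v k
      rw [h, DirectSum.decompose_smul, DirectSum.smul_apply, ← sub_eq_zero, ← sub_smul,
        smul_eq_zero] at h1
      refine Eq.trans (h1.resolve_left fun h2 => hk ?_)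
        (DirectSum.of_eq_of_ne (β := fun i => A.grading i) _ _ _ (Ne.symm hk)).symm
      exact_mod_cast sub_eq_zero.mp h2
  have h3 := congrArg (DirectSum.decompose A.grading).symm hv
  rw [Equiv.symm_apply_apply, DirectSum.decompose_symm_of] at h3
  rw [h3]
  exact Subtype.prop _

/-- `uₖ` has weight `wt u - k - 1`. -/
theorem mode_mem {d e : ℤ} {u v : V} (hu : u ∈ A.grading d) (hv : v ∈ A.grading e) (k : ℤ) :
    A.mode u k v ∈ A.grading (d + e - k - 1) := by
  rw [mem_grading_iff]
  have h := A.L_zero_coeff hu (-k - 1) v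
  rw [(A.mem_grading_iff e v).1 hv, map_smul, sub_eq_iff_eq_add, ← add_smul] at h
  refine Eq.trans h ?_
  rw [show A.mode u k v = coeff (A.Y u) (-k - 1) v from rfl]
  congr 1
  push_cast
  ring

theorem summable_X (u : V) : FormalSeries.Summable fun m : ℤ =>
    monomialMul m (coeff (A.Y (A.xPowLZero u m))) := fun p => by
  refine (A.finite_support_xPowLZero u).subset fun m hm h => hm ?_
  simp only [monomialMul, h, map_zero, Pi.zero_apply]

theorem X_add (u v : V) : A.X (u + v) = A.X u + A.X v := by
  rw [X, X, X, ← sum_add (A.summable_X u) (A.summable_X v)]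
  congr 1
  funext m
  simp [xPowLZero_add, monomialMul_add]

theorem X_zero : A.X 0 = 0 := by
  rw [X, ← FormalSeries.sum_zero (ι := ℤ)]
  congr 1
  funext m p
  simp [xPowLZero_zero, monomialMul]

/-- `X(u, x) = x ^ wt u Y(u, x)` for homogeneous `u`. -/
theorem X_of_mem {d : ℤ} {u : V} (hu : u ∈ A.grading d) (p : ℤ) :
    A.X u p = coeff (A.Y u) (p - d) := by
  refine (finsum_eq_single _ d fun m hm => ?_).trans ?_
  · simp only [monomialMul, A.xPowLZero_of_mem hu, if_neg hm, map_zero, Pi.zero_apply]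
  · simp only [monomialMul, A.xPowLZero_of_mem hu, if_true]

theorem exists_X_eq_zero (u w : V) : ∃ N : ℤ, ∀ p < N, A.X u p w = 0 := by
  induction u using A.grading_induction with
  | zero => exact ⟨0, fun p _ => by simp [X_zero]⟩
  | homogeneous d u hu =>
    obtain ⟨N, hN⟩ := A.exists_coeff_eq_zero u w
    exact ⟨N + d, fun p hp => by rw [A.X_of_mem hu, hN _ (by omega)]⟩
  | add u v hu hv =>
    obtain ⟨N, hN⟩ := hu
    obtain ⟨N', hN'⟩ := hv
    refine ⟨min N N', fun p hp => ?_⟩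
    rw [X_add, Pi.add_apply, LinearMap.add_apply, hN p (by omega), hN' p (by omega), add_zero]

theorem mulExists_subPow_X (n : ℤ) (u v w : V) :
    MulExists (subPow n) (fun p : ℤ × ℤ => A.X u p.1 (A.X v p.2 w)) := by
  obtain ⟨N, hN⟩ := A.exists_X_eq_zero v w
  exact mulExists_subPow n N _ fun p hp => by rw [hN _ hp, map_zero]

theorem mulExists_negAddPow_X (n : ℤ) (u v w : V) :
    MulExists (negAddPow n) (fun p : ℤ × ℤ => A.X v p.2 (A.X u p.1 w)) := by
  obtain ⟨N, hN⟩ := A.exists_X_eq_zero u w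
  exact mulExists_negAddPow n N _ fun p hp => by rw [hN _ hp, map_zero]

/-! ### The Jacobi identity for modified vertex operators. -/

/-- The family on the right-hand side of the Jacobi identity for modified vertex operators. -/
def iterateFamily (n d : ℤ) (u v w : V) : ℤ × Set.Ici n → ℤ × ℤ → V := fun i =>
  Ring.choose (d - i.1 - 1) ((i.2 : ℤ) - n).toNat •
    monomialMul (i.1, n - i.1) (inX₂ fun r => A.X (A.mode u i.2 v) r w)

theorem iterateFamily_apply (n d : ℤ) (u v w : V) (i : ℤ × Set.Ici n) (p : ℤ × ℤ) :
    A.iterateFamily n d u v w i p = Ring.choose (d - i.1 - 1) ((i.2 : ℤ) - n).toNat •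
      if p.1 - i.1 = 0 then A.X (A.mode u i.2 v) (p.2 - (n - i.1)) w else 0 := rfl

theorem iterateFamily_add (n d : ℤ) (u v v' w : V) :
    A.iterateFamily n d u (v + v') w
      = A.iterateFamily n d u v w + A.iterateFamily n d u v' w := by
  funext i p
  simp only [iterateFamily_apply, Pi.add_apply, map_add, X_add, LinearMap.add_apply]
  split_ifs <;> simp

theorem iterateFamily_zero (n d : ℤ) (u w : V) : A.iterateFamily n d u 0 w = 0 := by
  funext i p
  simp [iterateFamily_apply, X_zero]

theorem summable_iterateFamily (n d : ℤ) (u v w : V) :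
    FormalSeries.Summable (A.iterateFamily n d u v w) := fun p => by
  obtain ⟨N, hN⟩ := A.exists_coeff_eq_zero u v
  -- Truncation kills `uₖ v` once `-k - 1 < N`. The `max` only supplies the proof of membership in
  -- `Set.Ici n`; it equals `k` on the interval.
  refine ((Set.finite_Icc n (-N)).image fun k =>
    ((p.1, ⟨max n k, le_max_left n k⟩) : ℤ × Set.Ici n)).subset fun i hi => ?_
  have h1 : p.1 - i.1 = 0 := by
    by_contra h
    exact hi (by rw [iterateFamily_apply, if_neg h, smul_zero])
  have h2 : ¬ (-(i.2 : ℤ) - 1 < N) := fun h => hi (by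
    rw [iterateFamily_apply, show A.mode u i.2 v = coeff (A.Y u) (-(i.2 : ℤ) - 1) v from rfl,
      hN _ h, X_zero]
    simp)
  have h3 : n ≤ (i.2 : ℤ) := i.2.2
  exact ⟨i.2, ⟨h3, by omega⟩, Prod.ext (by simp; omega) (Subtype.ext (max_eq_right h3))⟩

/-- `X(uₖ v, x₂)` does not involve `x₁`, so the exponent of `x₁` forces `j = p₁` and only the sum
over `k = n + i` remains. -/
theorem sum_iterateFamily (n d : ℤ) (u v w : V) (p : ℤ × ℤ) :
    FormalSeries.sum (A.iterateFamily n d u v w) p = ∑ᶠ i : ℕ,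
      Ring.choose (d - p.1 - 1) i • A.X (A.mode u (n + i) v) (p.1 + p.2 - n) w := by
  have hle (i : ℕ) : n ≤ n + i := by omega
  rw [FormalSeries.sum, finsum_comp_of_injective
    (g := fun i : ℕ => ((p.1, ⟨n + i, hle i⟩) : ℤ × Set.Ici n))]
  · refine finsum_congr fun i => ?_
    rw [iterateFamily_apply]
    simp only [sub_self, if_true, add_sub_cancel_left, Int.toNat_natCast]
    rw [show p.2 - (n - p.1) = p.1 + p.2 - n by ring]
  · intro i j h
    simpa [Subtype.ext_iff] using h
  · intro i hi
    have h1 : p.1 - i.1 = 0 := by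
      by_contra h
      exact hi (by rw [iterateFamily_apply, if_neg h, smul_zero])
    have h3 : n ≤ (i.2 : ℤ) := i.2.2
    exact ⟨((i.2 : ℤ) - n).toNat, Prod.ext (by simp; omega) (Subtype.ext (by simp; omega))⟩

/-- The Jacobi identity for modified vertex operators of homogeneous vectors. -/
theorem X_jacobi_of_mem {d e : ℤ} {u v : V} (hu : u ∈ A.grading d) (hv : v ∈ A.grading e)
    (n : ℤ) (w : V) :
    mul (subPow n) (fun p : ℤ × ℤ => A.X u p.1 (A.X v p.2 w))
      - mul (negAddPow n) (fun p : ℤ × ℤ => A.X v p.2 (A.X u p.1 w))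
      = FormalSeries.sum (A.iterateFamily n d u v w) := by
  have hF : (fun p : ℤ × ℤ => A.X u p.1 (A.X v p.2 w)) = monomialMul (d, e)
      fun p => coeff (A.Y u) p.1 (coeff (A.Y v) p.2 w) := by
    funext p
    simp only [A.X_of_mem hu, A.X_of_mem hv, monomialMul, Prod.fst_sub, Prod.snd_sub]
  have hG : (fun p : ℤ × ℤ => A.X v p.2 (A.X u p.1 w)) = monomialMul (d, e)
      fun p => coeff (A.Y v) p.2 (coeff (A.Y u) p.1 w) := by
    funext p
    simp only [A.X_of_mem hu, A.X_of_mem hv, monomialMul, Prod.fst_sub, Prod.snd_sub]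
  funext p
  rw [hF, hG, mul_monomialMul, mul_monomialMul, sum_iterateFamily]
  refine (A.jacobi_apply u v w n (p - (d, e))).trans (finsum_congr fun i => ?_)
  rw [A.X_of_mem (A.mode_mem hu hv _), Prod.fst_sub, Prod.snd_sub]
  dsimp only
  congr 3
  · ring
  · exact congrArg _ (by ring)

/-- The Jacobi identity for modified vertex operators. -/
theorem X_jacobi {d : ℤ} {u : V} (hu : u ∈ A.grading d) (v : V) (n : ℤ) (w : V) :
    mul (subPow n) (fun p : ℤ × ℤ => A.X u p.1 (A.X v p.2 w))
      - mul (negAddPow n) (fun p : ℤ × ℤ => A.X v p.2 (A.X u p.1 w))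
      = FormalSeries.sum (A.iterateFamily n d u v w) := by
  induction v using A.grading_induction with
  | zero =>
    have hF : (fun p : ℤ × ℤ => A.X u p.1 (A.X 0 p.2 w)) = 0 := by
      funext p
      simp [X_zero]
    have hG : (fun p : ℤ × ℤ => A.X 0 p.2 (A.X u p.1 w)) = 0 := by
      funext p
      simp [X_zero]
    rw [hF, hG, iterateFamily_zero, FormalSeries.sum_zero, FormalSeries.mul_zero,
      FormalSeries.mul_zero, sub_zero]
  | homogeneous e v hv => exact A.X_jacobi_of_mem hu hv n w
  | add v v' hv hv' =>
    have hF : (fun p : ℤ × ℤ => A.X u p.1 (A.X (v + v') p.2 w))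
        = (fun p : ℤ × ℤ => A.X u p.1 (A.X v p.2 w))
          + fun p : ℤ × ℤ => A.X u p.1 (A.X v' p.2 w) := by
      funext p
      simp [X_add]
    have hG : (fun p : ℤ × ℤ => A.X (v + v') p.2 (A.X u p.1 w))
        = (fun p : ℤ × ℤ => A.X v p.2 (A.X u p.1 w))
          + fun p : ℤ × ℤ => A.X v' p.2 (A.X u p.1 w) := by
      funext p
      simp [X_add]
    -- Summability is essential here: `finsum` returns `0` on infinite support, so it is not
    -- additive in general.
    rw [hF, hG, iterateFamily_add,
      FormalSeries.sum_add (A.summable_iterateFamily n d u v w)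
        (A.summable_iterateFamily n d u v' w),
      FormalSeries.mul_add (A.mulExists_subPow_X n u v w) (A.mulExists_subPow_X n u v' w),
      FormalSeries.mul_add (A.mulExists_negAddPow_X n u v w) (A.mulExists_negAddPow_X n u v' w),
      add_sub_add_comm, hv, hv']

end VertexOperatorAlgebra

end

open FormalSeries in
theorem mainTheorem3 {V : Type*} [AddCommGroup V] [Module ℂ V] (A : VertexOperatorAlgebra V)
    (n d : ℤ) (u v : V) (hu : u ∈ A.grading d) (w : V) :
    MulExists (subPow n) (fun p : ℤ × ℤ => A.X u p.1 (A.X v p.2 w)) ∧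
    MulExists (negAddPow n) (fun p : ℤ × ℤ => A.X v p.2 (A.X u p.1 w)) ∧
    FormalSeries.Summable (fun i : ℤ × Set.Ici n =>
      Ring.choose (d - i.1 - 1) ((i.2 : ℤ) - n).toNat •
        monomialMul (i.1, n - i.1) (inX₂ fun r => A.X (A.mode u i.2 v) r w)) ∧
    mul (subPow n) (fun p : ℤ × ℤ => A.X u p.1 (A.X v p.2 w))
      - mul (negAddPow n) (fun p : ℤ × ℤ => A.X v p.2 (A.X u p.1 w))
      = FormalSeries.sum (fun i : ℤ × Set.Ici n =>
          Ring.choose (d - i.1 - 1) ((i.2 : ℤ) - n).toNat •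
            monomialMul (i.1, n - i.1) (inX₂ fun r => A.X (A.mode u i.2 v) r w)) := by
  exact ⟨A.mulExists_subPow_X n u v w, A.mulExists_negAddPow_X n u v w,
    A.summable_iterateFamily n d u v w, A.X_jacobi hu v n w⟩
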